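/- Let $R$ be a Prüfer domain of finite character, that is, an integral domain such that for every maximal ideal $P$ the ideals of the localization $R_P$ are linearly ordered by inclusion, and such that every non-zero element of $R$ is contained in only finitely many maximal ideals. Then for every injective $R$-module $G$ and every multiplicative subset $S$ of $R$, the localization $S^{-1}G$ is injective, both as an $S^{-1}R$-module and as an $R$-module. -/

import Mathlib

universe u v

/-- A module is uniserial if its submodules are linearly ordered by inclusion. -/
def IsUniserialModule (R M : Type*) [CommRing R] [AddCommGroup M] [Module R M] : Prop :=
  ∀ N N' : Submodule R M, N ≤ N' ∨ N' ≤ N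

/-- A commutative ring is arithmetical if its localization at every maximal ideal is a valuation
ring, that is, uniserial as a module over itself (zero divisors are allowed). -/
def IsArithmeticalRing (R : Type*) [CommRing R] : Prop :=
  ∀ (P : Ideal R) [P.IsMaximal],
    IsUniserialModule (Localization.AtPrime P) (Localization.AtPrime P)

/-- A Prüfer domain is an arithmetical integral domain. -/
structure IsPruferDomain (R : Type*) [CommRing R] : Prop where
  isDomain : IsDomain R
  isArithmeticalRing : IsArithmeticalRing R

/-- Finite character: every non-zero element is contained in only finitely many maximal ideals. -/
def HasFiniteCharacter (R : Type*) [CommRing R] : Prop :=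
  ∀ r : R, r ≠ 0 → {P : Ideal R | P.IsMaximal ∧ r ∈ P}.Finite

/-!
Injectivity is treated throughout in the form of Baer's criterion (`Module.Baer`): every linear map
`f` from an ideal `I` to `Q` is multiplication by an element of `Q`. This form is free of universe
constraints and passes between `R` and its localizations in both directions
(`Module.Baer.of_baer_localization`, `Module.Baer.localization_of_baer`).

For each maximal ideal `P` embed `G_P` in an injective `R_P`-module `E_P`. Then `G` embeds in
`∏ E_P`, hence is a retract of it, and `S⁻¹G` is a retract of `S⁻¹(∏ E_P)`. This replaces `G` by a
product of modules over valuation domains and avoids any gluing of local solutions of `f a = a • x`.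

* Over a valuation domain `V` with an injective module `E`
  (`Module.Baer.of_isLocalizedModule_of_total`), let `L` be the ideal of the elements divisible by
  every `s ∈ S`. It annihilates the kernel of `E → S⁻¹E`, so for `c ∈ L` and `m ∈ S⁻¹E` the product
  `c • m` has a canonical lift to `E`. Given `f : I → S⁻¹E`, either `S⁻¹I` is principal, and
  divisibility of `S⁻¹E` solves the problem, or every element of `I` is a multiple `c * a'` with
  `c ∈ L` and `a' ∈ I`; then `f` lifts canonically to `I → E`, where Baer's criterion applies.
* For the product (`HasFiniteCharacter.baer_localizedModule_pi`), fix a nonzero `b ∈ I`. At the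
  maximal ideals not containing `b`, a solution is forced by `f b`, and divisibility provides one for
  all of them at once. The finitely many remaining factors are solved separately; finiteness is what
  allows a common denominator in `S`.
-/

/-! ### Baer's criterion over commutative rings -/

namespace Module.Baer

theorem iff_exists_smul {R Q : Type*} [CommRing R] [AddCommGroup Q] [Module R Q] :
    Module.Baer R Q ↔ ∀ (I : Ideal R) (f : I →ₗ[R] Q), ∃ x : Q, ∀ a : I, f a = (a : R) • x := by
  constructor
  · intro h I f
    obtain ⟨g, hg⟩ := h I f
    exact ⟨g 1, fun a => by rw [← hg a a.2, ← map_smul, smul_eq_mul, mul_one]⟩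
  · intro h I f
    obtain ⟨x, hx⟩ := h I f
    exact ⟨LinearMap.toSpanSingleton R Q x, fun a ha => by simp [hx]⟩

/-- Injective modules over a domain are divisible. -/
theorem exists_smul_eq {R Q : Type*} [CommRing R] [IsDomain R] [AddCommGroup Q] [Module R Q]
    (h : Module.Baer R Q) {b : R} (hb : b ≠ 0) (y : Q) : ∃ x : Q, b • x = y := by
  let e := LinearEquiv.toSpanNonzeroSingleton R R b hb
  obtain ⟨x, hx⟩ := iff_exists_smul.1 h _ (LinearMap.toSpanSingleton R Q y ∘ₗ e.symm.toLinearMap)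
  refine ⟨x, ?_⟩
  have := hx (e 1)
  rw [LinearMap.comp_apply, LinearEquiv.coe_coe, e.symm_apply_apply] at this
  simpa [e] using this.symm

theorem of_subsingleton {R Q : Type*} [CommRing R] [AddCommGroup Q] [Module R Q]
    [Subsingleton Q] : Module.Baer R Q :=
  iff_exists_smul.2 fun _ _ => ⟨0, fun _ => Subsingleton.elim _ _⟩

/-- A retract of an injective module is injective. -/
theorem of_retract {R Q Q' : Type*} [CommRing R] [AddCommGroup Q] [Module R Q]
    [AddCommGroup Q'] [Module R Q'] (h : Module.Baer R Q') (i : Q →ₗ[R] Q') (p : Q' →ₗ[R] Q)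
    (hpi : p ∘ₗ i = LinearMap.id) : Module.Baer R Q := by
  intro I f
  obtain ⟨g, hg⟩ := h I (i ∘ₗ f)
  refine ⟨p ∘ₗ g, fun a ha => ?_⟩
  simpa [hg a ha] using LinearMap.congr_fun hpi (f ⟨a, ha⟩)

/-- An injective module over a localization `A` of `R` is injective over `R`. -/
theorem of_baer_localization {R A M : Type*} [CommRing R] [CommRing A] [Algebra R A]
    (T : Submonoid R) [IsLocalization T A] [AddCommGroup M] [Module R M] [Module A M]
    [IsScalarTower R A M] (h : Module.Baer A M) : Module.Baer R M := by
  rw [iff_exists_smul] at h ⊢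
  intro I f
  have hu : ∀ t : T, IsUnit (algebraMap R (Module.End R M) t) := fun t =>
    (Module.End.isUnit_iff _).2 <| by
      obtain ⟨u, hu⟩ := IsLocalization.map_units A t
      convert! MulAction.bijective u using 2 with m
      rw [Units.smul_def, hu, algebraMap_smul, Module.algebraMap_end_apply]
  let g : I.map (algebraMap R A) →ₗ[R] M := IsLocalizedModule.lift T (Algebra.idealMap A I) f hu
  obtain ⟨x, hx⟩ := h _ (g.extendScalarsOfIsLocalization T A)
  refine ⟨x, fun a => ?_⟩
  have h1 := hx (Algebra.idealMap A I a)
  have h2 : g (Algebra.idealMap A I a) = f a := IsLocalizedModule.lift_apply T _ f hu a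
  simpa [h2] using h1

/-- A module over a localization `A` of `R` that is injective over `R` is injective over `A`. -/
theorem localization_of_baer {R A M : Type*} [CommRing R] [CommRing A] [Algebra R A]
    (T : Submonoid R) [IsLocalization T A] [AddCommGroup M] [Module R M] [Module A M]
    [IsScalarTower R A M] (h : Module.Baer R M) : Module.Baer A M := by
  rw [iff_exists_smul] at h ⊢
  intro J f
  let k : J.comap (algebraMap R A) →ₗ[R] J :=
    { toFun := fun a => ⟨algebraMap R A a, a.2⟩
      map_add' := fun a b => by ext; simp
      map_smul' := fun r a => by ext; simp [Algebra.smul_def] }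
  obtain ⟨x, hx⟩ := h _ (f.restrictScalars R ∘ₗ k)
  refine ⟨x, fun j => ?_⟩
  obtain ⟨⟨a, t⟩, hat⟩ := IsLocalization.surj T (j : A)
  have hmem : algebraMap R A a ∈ J := hat ▸ J.mul_mem_right _ j.2
  have h1 : f ⟨algebraMap R A a, hmem⟩ = a • x := hx ⟨a, hmem⟩
  have h2 : (⟨algebraMap R A a, hmem⟩ : J) = algebraMap R A t • j := by
    ext; simp [← hat, mul_comm, Algebra.smul_def]
  rw [h2, map_smul, ← algebraMap_smul A a, ← hat, mul_comm, mul_smul] at h1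
  exact (IsLocalization.map_units A t).smul_left_cancel.1 h1

end Module.Baer

/-! ### Embedding in an injective module -/

/-- There are enough injectives, stated for unbundled modules. -/
theorem Module.exists_baer_embedding {R : Type u} [CommRing R] (X : Type max u v)
    [AddCommGroup X] [Module R X] :
    ∃ (E : Type max u v) (_ : AddCommGroup E) (_ : Module R E) (j : X →ₗ[R] E),
      Function.Injective j ∧ Module.Baer R E := by
  obtain ⟨p⟩ := (ModuleCat.enoughInjectives.{v} R).presentation (ModuleCat.of R X)
  have := p.injective
  have : Module.Injective R p.J := Module.injective_module_of_injective_object R p.J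
  exact ⟨p.J, inferInstance, inferInstance, p.f.hom, (ModuleCat.mono_iff_injective _).1 p.mono,
    Module.Baer.of_injective this⟩

/-! ### Localizing injective modules over a valuation domain -/

section Valuation

variable {V E M : Type*} [CommRing V] [AddCommGroup E] [Module V E] [AddCommGroup M] [Module V M]

theorem IsLocalizedModule.surjective_of_divisible {S : Submonoid V}
    (l : E →ₗ[V] M) [IsLocalizedModule S l] (hE : ∀ s ∈ S, ∀ e : E, ∃ x, s • x = e) :
    Function.Surjective l := by
  intro m
  obtain ⟨⟨e, s⟩, h⟩ := IsLocalizedModule.surj S l m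
  obtain ⟨x, hx⟩ := hE s s.2 e
  refine ⟨x, IsLocalizedModule.smul_injective l s ?_⟩
  change (s : V) • l x = s • m
  rw [h, ← map_smul, hx]

theorem exists_dvd_of_mem_of_total (hV : ∀ a b : V, a ∣ b ∨ b ∣ a) (L : Ideal V) {x y : V}
    (hx : x ∈ L) (hy : y ∈ L) : ∃ c ∈ L, c ∣ x ∧ c ∣ y := by
  rcases hV x y with h | h
  · exact ⟨x, hx, dvd_rfl, h⟩
  · exact ⟨y, hy, h, dvd_rfl⟩

/-- If every element of `L` is divisible by all of `S`, then sending `c * a` to `c • g`, where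
`c ∈ L` and `g` lifts `f a`, respects linear relations between three terms. This makes the lift of `f`
in `Module.Baer.of_isLocalizedModule_of_total` independent of choices and linear. -/
theorem smul_lifts_eq_zero_of_mem_divisible [IsDomain V] (hV : ∀ a b : V, a ∣ b ∨ b ∣ a)
    {S : Submonoid V}
    (l : E →ₗ[V] M) [IsLocalizedModule S l] {L : Ideal V}
    (hL : ∀ c ∈ L, ∀ s ∈ S, s ∣ c) {I : Ideal V} (f : I →ₗ[V] M)
    {c₁ c₂ c₃ : V} (h₁ : c₁ ∈ L) (h₂ : c₂ ∈ L) (h₃ : c₃ ∈ L) {a₁ a₂ a₃ : I} {g₁ g₂ g₃ : E}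
    (e₁ : l g₁ = f a₁) (e₂ : l g₂ = f a₂) (e₃ : l g₃ = f a₃)
    (h : c₁ * a₁ + c₂ * a₂ + c₃ * a₃ = 0) : c₁ • g₁ + c₂ • g₂ + c₃ • g₃ = 0 := by
  -- A common divisor `c ∈ L` of the coefficients annihilates the kernel of `l`.
  obtain ⟨c', hc', ⟨d₁, rfl⟩, ⟨d₂, rfl⟩⟩ := exists_dvd_of_mem_of_total hV L h₁ h₂
  obtain ⟨c, hc, ⟨d', rfl⟩, ⟨d₃, rfl⟩⟩ := exists_dvd_of_mem_of_total hV L hc' h₃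
  by_cases hc0 : c = 0
  · simp [hc0]
  have h0 : d' * d₁ * a₁ + d' * d₂ * a₂ + d₃ * a₃ = 0 := by
    apply mul_left_cancel₀ hc0
    linear_combination h
  have hf : l ((d' * d₁) • g₁ + (d' * d₂) • g₂ + d₃ • g₃) = l 0 := by
    have : (d' * d₁) • a₁ + (d' * d₂) • a₂ + d₃ • a₃ = 0 := by ext; simpa using h0
    have := congrArg f this
    simpa [e₁, e₂, e₃] using this
  obtain ⟨s, hs⟩ := IsLocalizedModule.exists_of_eq (S := S) hf
  obtain ⟨r, rfl⟩ := hL c hc s s.2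
  have hs' : (s : V) • ((d' * d₁) • g₁ + (d' * d₂) • g₂ + d₃ • g₃) = 0 := by
    simpa [Submonoid.smul_def] using hs
  calc _ = r • (s : V) • ((d' * d₁) • g₁ + (d' * d₂) • g₂ + d₃ • g₃) := by module
    _ = 0 := by rw [hs', smul_zero]

/-- Over a valuation domain, localizations of injective modules are injective. -/
theorem Module.Baer.of_isLocalizedModule_of_total [IsDomain V] (hV : ∀ a b : V, a ∣ b ∨ b ∣ a)
    {S : Submonoid V} (hS : (0 : V) ∉ S) (l : E →ₗ[V] M) [IsLocalizedModule S l]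
    (hE : Module.Baer V E) : Module.Baer V M := by
  have hl := IsLocalizedModule.surjective_of_divisible (S := S) l fun s hs =>
    hE.exists_smul_eq fun h0 => hS (h0 ▸ hs)
  rw [iff_exists_smul]
  intro I f
  by_cases hI : ∃ a : I, ∀ a' : I, ∃ s ∈ S, (a : V) ∣ s * a'
  -- Here `a` generates `S⁻¹I`.
  · obtain ⟨a, ha⟩ := hI
    obtain ⟨x, hx⟩ : ∃ x : M, f a = (a : V) • x := by
      by_cases ha0 : a = 0
      · exact ⟨0, by simp [ha0]⟩
      obtain ⟨e, he⟩ := hl (f a)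
      obtain ⟨x, rfl⟩ := hE.exists_smul_eq (b := (a : V)) (by simpa using ha0) e
      exact ⟨l x, by rw [← he, map_smul]⟩
    refine ⟨x, fun a' => ?_⟩
    obtain ⟨s, hs, t, ht⟩ := ha a'
    have h1 : s • a' = t • a := by ext; simp [ht, mul_comm]
    apply IsLocalizedModule.smul_injective l ⟨s, hs⟩
    change s • f a' = s • (a' : V) • x
    rw [← map_smul, h1, map_smul, hx, smul_smul, smul_smul, ht, mul_comm]
  -- Here `S⁻¹I` is not principal, and `I` consists of `L`-multiples of its elements.
  · push Not at hI
    let L : Ideal V := ⨅ s : S, Ideal.span {(s : V)}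
    have hL : ∀ c ∈ L, ∀ s ∈ S, s ∣ c := fun c hc s hs =>
      Ideal.mem_span_singleton.1 ((Submodule.mem_iInf _).1 hc ⟨s, hs⟩)
    have key : ∀ a : I, ∃ c ∈ L, ∃ a' : I, (a : V) = c * a' := by
      intro a
      obtain ⟨a', ha'⟩ := hI a
      have hdvd : ∀ s ∈ S, s * (a' : V) ∣ a := fun s hs =>
        (hV (s * a') a).resolve_right (ha' s hs)
      have ha'0 : (a' : V) ≠ 0 := fun h0 => ha' 1 S.one_mem (by simp [h0])
      obtain ⟨c, hc⟩ := hdvd 1 S.one_mem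
      refine ⟨c, (Submodule.mem_iInf _).2 fun s => Ideal.mem_span_singleton.2 ?_, a', ?_⟩
      · obtain ⟨r, hr⟩ := hdvd s s.2
        refine ⟨r, mul_left_cancel₀ ha'0 ?_⟩
        linear_combination hr - hc
      · linear_combination hc
    choose c hc a' hca using key
    choose g hg using fun a : I => hl (f (a' a))
    let F : I →ₗ[V] E :=
      { toFun := fun a => c a • g a
        map_add' := fun x y => by
          have := smul_lifts_eq_zero_of_mem_divisible hV (S := S) l hL f (hc x) (hc y)
            (neg_mem (hc (x + y))) (hg x) (hg y) (hg (x + y)) (by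
              rw [neg_mul, ← hca, ← hca, ← hca]; push_cast; ring)
          rw [neg_smul, add_neg_eq_zero] at this
          exact this.symm
        map_smul' := fun r x => by
          have := smul_lifts_eq_zero_of_mem_divisible hV (S := S) l hL f (L.mul_mem_left r (hc x))
            (neg_mem (hc (r • x))) L.zero_mem (hg x) (hg (r • x)) (hg x) (by
              rw [neg_mul, ← hca, mul_assoc, ← hca]; simp)
          rw [neg_smul, zero_smul, add_zero, add_neg_eq_zero, mul_smul] at this
          exact this.symm }
    obtain ⟨x, hx⟩ := iff_exists_smul.1 hE I F
    refine ⟨l x, fun a => ?_⟩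
    have h1 : c a • a' a = a := by ext; simp [← hca]
    rw [← map_smul, ← hx]
    change f a = l (c a • g a)
    rw [map_smul, hg, ← map_smul, h1]

end Valuation

/-! ### Prüfer domains of finite character -/

theorem IsPruferDomain.dvd_or_dvd_localization {R : Type*} [CommRing R] (hR : IsPruferDomain R)
    (P : Ideal R) [P.IsMaximal] (a b : Localization.AtPrime P) : a ∣ b ∨ b ∣ a := by
  have := hR.isArithmeticalRing P (Ideal.span {b}) (Ideal.span {a})
  rwa [Ideal.span_singleton_le_span_singleton, Ideal.span_singleton_le_span_singleton] at this

/-- The injective `R_P`-module `E` containing `G_P`, described by its properties over `R`: the map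
`G → E` has the kernel of `G → G_P`, elements outside `P` act injectively on `E`, and both `E` and
`S⁻¹E` are injective over `R`. -/
theorem IsPruferDomain.exists_local_envelope {R : Type u} [CommRing R] (hR : IsPruferDomain R)
    (G : Type v) [AddCommGroup G] [Module R G] (S : Submonoid R) (hS : (0 : R) ∉ S)
    (P : Ideal R) [P.IsMaximal] :
    ∃ (E : Type max u v) (_ : AddCommGroup E) (_ : Module R E) (j : G →ₗ[R] E),
      (∀ g, j g = 0 → ∃ t ∉ P, t • g = 0) ∧ (∀ t ∉ P, ∀ e : E, t • e = 0 → e = 0) ∧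
      Module.Baer R E ∧ Module.Baer R (LocalizedModule S E) := by
  have := hR.isDomain
  let V := Localization.AtPrime P
  have : IsDomain V := IsLocalization.isDomain_localization P.primeCompl_le_nonZeroDivisors
  obtain ⟨E, _, _, j, hj, hE⟩ := Module.exists_baer_embedding.{u, max u v} (R := V)
    (LocalizedModule P.primeCompl G)
  let _ : Module R E := Module.compHom E (algebraMap R V)
  have : IsScalarTower R V E := IsScalarTower.of_algebraMap_smul fun _ _ => rfl
  refine ⟨E, inferInstance, inferInstance,
    j.restrictScalars R ∘ₗ LocalizedModule.mkLinearMap P.primeCompl G, ?_, ?_,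
    hE.of_baer_localization P.primeCompl, ?_⟩
  · intro g hg
    have h1 : LocalizedModule.mkLinearMap P.primeCompl G g = 0 := hj (by simpa using hg)
    obtain ⟨t, ht⟩ := (IsLocalizedModule.eq_zero_iff P.primeCompl _).1 h1
    exact ⟨t, t.2, ht⟩
  · intro t ht e he
    have hu : IsUnit (algebraMap R V t) := IsLocalization.map_units V (⟨t, ht⟩ : P.primeCompl)
    exact hu.smul_eq_zero.1 (by rwa [algebraMap_smul])
  · let S' := Algebra.algebraMapSubmonoid V S
    have hS' : (0 : V) ∉ S' := by
      rintro ⟨s, hs, h0⟩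
      have hinj := IsLocalization.injective V P.primeCompl_le_nonZeroDivisors
      exact hS ((map_eq_zero_iff _ hinj).1 h0 ▸ hs)
    have hM := hE.of_isLocalizedModule_of_total (hR.dvd_or_dvd_localization P) hS'
      (LocalizedModule.mkLinearMap S' E)
    have := IsLocalizedModule.restrictScalars S (LocalizedModule.mkLinearMap S' E)
    exact (hM.of_baer_localization P.primeCompl).of_equiv
      (IsLocalizedModule.iso S ((LocalizedModule.mkLinearMap S' E).restrictScalars R)).symm

/-- Over a domain of finite character, `S⁻¹` of a product of injective modules, one for each maximal
ideal `P` and with `R \ P` acting injectively on it, is injective as soon as `S⁻¹` of each factor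
is. -/
theorem HasFiniteCharacter.baer_localizedModule_pi {R : Type*} [CommRing R] [IsDomain R]
    (hfc : HasFiniteCharacter R) {S : Submonoid R} (hS : (0 : R) ∉ S)
    (E : MaximalSpectrum R → Type*) [∀ P, AddCommGroup (E P)] [∀ P, Module R (E P)]
    (hloc : ∀ P, ∀ t ∉ P.asIdeal, ∀ e : E P, t • e = 0 → e = 0)
    (hE : ∀ P, Module.Baer R (E P)) (hSE : ∀ P, Module.Baer R (LocalizedModule S (E P))) :
    Module.Baer R (LocalizedModule S (∀ P, E P)) := by
  classical
  have hS0 : ∀ s ∈ S, s ≠ 0 := fun s hs h0 => hS (h0 ▸ hs)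
  have hdiv : ∀ b : R, b ≠ 0 → ∀ y : ∀ P, E P, ∃ x, b • x = y := fun b hb y => by
    choose x hx using fun P => (hE P).exists_smul_eq hb (y P)
    exact ⟨x, funext hx⟩
  let l := LocalizedModule.mkLinearMap S (∀ P, E P)
  let lE := fun P => LocalizedModule.mkLinearMap S (E P)
  have hl : Function.Surjective l :=
    IsLocalizedModule.surjective_of_divisible (S := S) l fun s hs => hdiv s (hS0 s hs)
  have hlE : ∀ P, Function.Surjective (lE P) := fun P =>
    IsLocalizedModule.surjective_of_divisible (S := S) (lE P) fun s hs =>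
      (hE P).exists_smul_eq (hS0 s hs)
  rw [Module.Baer.iff_exists_smul]
  intro I f
  by_cases hI : ∀ a : I, a = 0
  · exact ⟨0, fun a => by simp [hI a]⟩
  push Not at hI
  obtain ⟨b, hb⟩ := hI
  have hb' : (b : R) ≠ 0 := by simpa using hb
  obtain ⟨z, hz⟩ : ∃ z, f b = (b : R) • l z := by
    obtain ⟨y, hy⟩ := hl (f b)
    obtain ⟨z, rfl⟩ := hdiv b hb' y
    exact ⟨z, by rw [← hy, map_smul]⟩
  let pr := fun P => IsLocalizedModule.map S l (lE P) (LinearMap.proj P)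
  have hpr : ∀ P g, pr P (l g) = lE P (g P) := fun P g => IsLocalizedModule.map_apply S l (lE P) _ g
  have hx : ∀ P, ∃ e : E P, ∀ a : I, pr P (f a) = (a : R) • lE P e := fun P => by
    obtain ⟨x, hx⟩ := Module.Baer.iff_exists_smul.1 (hSE P) I (pr P ∘ₗ f)
    obtain ⟨e, rfl⟩ := hlE P x
    exact ⟨e, hx⟩
  choose e he using hx
  -- `e P` solves the problem at `P`, while `z P` solves it wherever `b` acts injectively.
  let y : ∀ P, E P := fun P => if (b : R) ∈ P.asIdeal then e P else z P
  refine ⟨l y, fun a => ?_⟩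
  obtain ⟨g, hg⟩ := hl (f a)
  rw [← hg, ← map_smul]
  have hfin : {P : MaximalSpectrum R | (b : R) ∈ P.asIdeal}.Finite :=
    Set.Finite.of_finite_image ((hfc b hb').subset (by
      rintro _ ⟨P, hP, rfl⟩
      exact ⟨P.isMaximal, hP⟩)) (fun P _ Q _ h => MaximalSpectrum.ext h)
  have hlocal : ∀ P, ∃ s : S, s • g P = s • (a : R) • e P := fun P => by
    refine IsLocalizedModule.exists_of_eq (f := lE P) ?_
    rw [← hpr, hg, he, map_smul]
  choose s hs using hlocal
  -- `b • f a = a • f b` holds up to a single denominator, at all `P` simultaneously.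
  obtain ⟨s₀, hs₀⟩ : ∃ s₀ : S, s₀ • (b : R) • g = s₀ • (a : R) • (b : R) • z := by
    refine IsLocalizedModule.exists_of_eq (f := l) ?_
    rw [map_smul, map_smul, map_smul, hg, ← hz, ← map_smul, ← map_smul]
    congr 1
    ext
    simp [mul_comm]
  apply (IsLocalizedModule.eq_iff_exists S l).2
  refine ⟨s₀ * ∏ P ∈ hfin.toFinset, s P, funext fun P => ?_⟩
  by_cases hP : (b : R) ∈ P.asIdeal
  · obtain ⟨r, hr⟩ : s P ∣ s₀ * ∏ P ∈ hfin.toFinset, s P :=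
      dvd_mul_of_dvd_right (Finset.dvd_prod_of_mem s (by simpa using hP)) s₀
    simp only [Pi.smul_apply, y, if_pos hP]
    rw [hr, mul_comm, mul_smul, hs, ← mul_smul]
  · have h1 := congrFun hs₀ P
    simp only [Pi.smul_apply, Submonoid.smul_def] at h1
    have h2 : (s₀ : R) • (g P - (a : R) • z P) = 0 := by
      apply hloc P b hP
      rw [← sub_eq_zero] at h1
      rw [← h1]
      module
    rw [smul_sub, sub_eq_zero] at h2
    simp only [Pi.smul_apply, y, if_neg hP]
    rw [mul_comm, mul_smul, mul_smul]
    exact congrArg _ h2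

/-- Over a Prüfer domain of finite character, localizations of injective modules are injective. -/
theorem IsPruferDomain.baer_localizedModule {R : Type u} [CommRing R] (hR : IsPruferDomain R)
    (hfc : HasFiniteCharacter R) {G : Type v} [AddCommGroup G] [Module R G]
    (hG : Module.Baer R G) (S : Submonoid R) : Module.Baer R (LocalizedModule S G) := by
  have := hR.isDomain
  by_cases hS : (0 : R) ∈ S
  · have := LocalizedModule.subsingleton (M := G) hS
    exact .of_subsingleton
  choose E _ _ j hj hloc hE hSE using fun P : MaximalSpectrum R =>
    have := P.isMaximal
    hR.exists_local_envelope G S hS P.asIdeal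
  have hprod := hfc.baer_localizedModule_pi hS E hloc hE hSE
  have hι : Function.Injective (LinearMap.pi j) := by
    rw [injective_iff_map_eq_zero]
    intro g hg
    -- Otherwise the annihilator of `g` lies in some `P`, and `g` survives in `G_P`.
    by_contra hg0
    obtain ⟨P, hP, hle⟩ := Ideal.exists_le_maximal (LinearMap.ker (LinearMap.toSpanSingleton R G g))
      fun h => hg0 (by simpa using (Ideal.eq_top_iff_one _).1 h)
    obtain ⟨t, ht, htg⟩ := hj ⟨P, hP⟩ g (congrFun hg ⟨P, hP⟩)
    exact ht (hle (by simpa using htg))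
  obtain ⟨p, hp⟩ := hG.extension_property _ hι LinearMap.id
  let lG := LocalizedModule.mkLinearMap S G
  let lE := LocalizedModule.mkLinearMap S (∀ P, E P)
  refine hprod.of_retract (IsLocalizedModule.map S lG lE (LinearMap.pi j))
    (IsLocalizedModule.map S lE lG p) ?_
  rw [← IsLocalizedModule.map_comp' S lG lE lG, hp, IsLocalizedModule.map_id]

theorem theorem10 {R : Type u} [CommRing R] (hR : IsPruferDomain R) (hfc : HasFiniteCharacter R)
    {G : Type v} [AddCommGroup G] [Module R G] [Small.{v} R] (hG : Module.Injective R G)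
    (S : Submonoid R) :
    Module.Injective (Localization S) (LocalizedModule S G) ∧
      Module.Injective R (LocalizedModule S G) := by
  have h := hR.baer_localizedModule hfc (Module.Baer.of_injective hG) S
  exact ⟨(h.localization_of_baer S).injective, h.injective⟩
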